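/- Let $(a_i)_{i\ge1}$ be a sequence of real numbers and let $(\gamma_i)_{i\ge1}$, $(\sigma_i)_{i\ge1}$ be sequences of positive real numbers. Consider the infinite-dimensional linear-Gaussian inverse problem $$y_i = a_i u_i + \eta_i,\qquad u_i\sim\mathcal N(0,\sigma_i^2),\qquad \eta_i\sim\mathcal N(0,\gamma_i^2),\qquad i=1,2,\dots,$$ where all the $u_i$ and $\eta_i$ are independent. Let $\pi_i=\mathcal N(0,\sigma_i^2)$, and let $\mu_i$ be the posterior of $u_i$ given $y_i$, that is, the probability measure on $\mathbb R$ given by Bayes' rule, $$\mu_i(du)\;\propto\;\exp\Bigl(-\frac{(y_i-a_iu)^2}{2\gamma_i^2}\Bigr)\,\pi_i(du).$$ Let $\pi_{1:\infty}=\prod_{i=1}^\infty\pi_i$ be the prior and $\mu_{1:\infty}=\prod_{i=1}^\infty\mu_i$ the posterior given the data $y=(y_i)_{i\ge1}$, both probability measures on $\mathbb R^{\mathbb N}$. Set $\lambda_i=a_i^2\sigma_i^2/\gamma_i^2$ and $$\rho_\infty = d_{\chi^2}(\mu_{1:\infty}\,\|\,\pi_{1:\infty})+1 ,$$ where $d_{\chi^2}(\mu\|\pi)=\int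 \bigl(\tfrac{d\mu}{d\pi}\bigr)^2\,d\pi-1$ if $\mu\ll\pi$ and $d_{\chi^2}(\mu\|\pi)=\infty$ otherwise; thus $\mu_{1:\infty}$ and $\rho_\infty$ depend on $y$. Here ``for almost every $y$'' refers to the law of the data $y=(a_iu_i+\eta_i)_{i\ge1}$. Then the following statements are equivalent: 1. $\tau=\sum_{i=1}^\infty\lambda_i<\infty$; 2. $\rho_\infty<\infty$ for almost every $y$; 3. $\mu_{1:\infty}\ll\pi_{1:\infty}$ for almost every $y$. -/

import Mathlib

open MeasureTheory ProbabilityTheory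
open scoped NNReal ENNReal

namespace LinearGaussian

noncomputable section

/-- The prior `𝒩(0, σ²)` on the unknown of the scalar inverse problem. -/
def priorOne (σ : ℝ≥0) : Measure ℝ := gaussianReal 0 (σ ^ 2)

/-- The likelihood of the scalar inverse problem `y = a u + η`, `η ∼ 𝒩(0, γ²)`: the density at the
datum `y` of the law `𝒩(a u, γ²)` of the data given `u`, as a function of `u`. -/
def likelihoodOne (a : ℝ) (γ : ℝ≥0) (y : ℝ) (u : ℝ) : ℝ≥0∞ := gaussianPDF (a * u) (γ ^ 2) y

/-- The evidence (marginal likelihood) of the datum `y`, i.e. the normalizing constant in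
Bayes' rule. -/
def evidenceOne (a : ℝ) (γ σ : ℝ≥0) (y : ℝ) : ℝ≥0∞ :=
  ∫⁻ u, likelihoodOne a γ y u ∂(priorOne σ)

/-- The posterior of the scalar inverse problem `y = a u + η`, `η ∼ 𝒩(0, γ²)`, `u ∼ 𝒩(0, σ²)`,
given by Bayes' rule: it is the prior weighted by the likelihood, and normalized. -/
def posteriorOne (a : ℝ) (γ σ : ℝ≥0) (y : ℝ) : Measure ℝ :=
  (evidenceOne a γ σ y)⁻¹ • (priorOne σ).withDensity (likelihoodOne a γ y)

theorem measurable_likelihoodOne (a : ℝ) (γ : ℝ≥0) (y : ℝ) :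
    Measurable (likelihoodOne a γ y) := by
  unfold likelihoodOne gaussianPDF gaussianPDFReal
  fun_prop

/-- For nondegenerate noise the evidence is positive and finite, so Bayes' rule defines a
probability measure for every datum `y`. -/
theorem isProbabilityMeasure_posteriorOne (a : ℝ) {γ : ℝ≥0} (hγ : 0 < γ) (σ : ℝ≥0) (y : ℝ) :
    IsProbabilityMeasure (posteriorOne a γ σ y) := by
  have hγ2 : γ ^ 2 ≠ 0 := (pow_pos hγ 2).ne'
  have hpos : evidenceOne a γ σ y ≠ 0 := by
    intro h0
    unfold evidenceOne priorOne at h0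
    rw [lintegral_eq_zero_iff (measurable_likelihoodOne a γ y)] at h0
    obtain ⟨u, hu⟩ := h0.exists
    exact (gaussianPDF_pos (a * u) hγ2 y).ne' hu
  have hfin : evidenceOne a γ σ y ≠ ∞ := by
    refine ne_top_of_le_ne_top (b := ENNReal.ofReal (√(2 * Real.pi * (γ ^ 2 : ℝ≥0)))⁻¹)
      ENNReal.ofReal_ne_top ?_
    calc evidenceOne a γ σ y
        ≤ ∫⁻ _, ENNReal.ofReal (√(2 * Real.pi * (γ ^ 2 : ℝ≥0)))⁻¹ ∂(priorOne σ) := by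
          refine lintegral_mono fun u => ENNReal.ofReal_le_ofReal ?_
          unfold gaussianPDFReal
          refine mul_le_of_le_one_right (by positivity) ?_
          rw [Real.exp_le_one_iff, neg_div]
          exact neg_nonpos.2 (by positivity)
      _ = _ := by simp [priorOne]
  constructor
  rw [posteriorOne, Measure.smul_apply, withDensity_apply _ MeasurableSet.univ,
    Measure.restrict_univ, smul_eq_mul]
  exact ENNReal.inv_mul_cancel hpos hfin

/-- The prior of the infinite-dimensional problem: the product of the scalar priors. -/
def priorInf (σ : ℕ → ℝ≥0) : Measure (ℕ → ℝ) := Measure.infinitePi fun i => priorOne (σ i)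

/-- The posterior of the infinite-dimensional problem given the data `y = (y_i)`: the product of
the scalar posteriors. -/
def posteriorInf (a : ℕ → ℝ) (γ σ : ℕ → ℝ≥0) (y : ℕ → ℝ) : Measure (ℕ → ℝ) :=
  Measure.infinitePi fun i => posteriorOne (a i) (γ i) (σ i) (y i)

/-- The law of the noise `η = (η_i)`, with independent coordinates `η_i ∼ 𝒩(0, γ_i²)`. -/
def noise (γ : ℕ → ℝ≥0) : Measure (ℕ → ℝ) :=
  Measure.infinitePi fun i => gaussianReal 0 ((γ i) ^ 2)

/-- The law of the data `y = (a_i u_i + η_i)_i`, where `u` is drawn from the prior and `η` is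
noise independent of `u`. -/
def dataLaw (a : ℕ → ℝ) (γ σ : ℕ → ℝ≥0) : Measure (ℕ → ℝ) :=
  ((priorInf σ).prod (noise γ)).map fun p i => a i * p.1 i + p.2 i

/-- The `χ²`-divergence `π(g²) - 1`, with `g = dμ/dπ`, of a probability measure `μ` from a
probability measure `π`; it is infinite if `μ` has no density with respect to `π`. The subtraction
is exact because `π(g²) ≥ π(g)² = 1`. -/
def chiSqDiv {Ω : Type*} [MeasurableSpace Ω] (μ π : Measure Ω) : ℝ≥0∞ :=
  open Classical in
  if μ ≪ π then (∫⁻ u, (μ.rnDeriv π u) ^ 2 ∂π) - 1 else ∞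

/-- The quantity `ρ_∞ = d_χ²(posterior ‖ prior) + 1` for the data `y`. -/
def rhoInf (a : ℕ → ℝ) (γ σ : ℕ → ℝ≥0) (y : ℕ → ℝ) : ℝ≥0∞ :=
  chiSqDiv (posteriorInf a γ σ y) (priorInf σ) + 1

/-- The ratios `λ_i = a_i² σ_i² / γ_i²`. -/
def lam (a : ℕ → ℝ) (γ σ : ℕ → ℝ≥0) (i : ℕ) : ℝ := (a i) ^ 2 * (σ i : ℝ) ^ 2 / (γ i : ℝ) ^ 2

/-- The intrinsic dimension `τ = ∑ λ_i`, a sum of nonnegative terms with values in `[0, ∞]`. -/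
def tau (a : ℕ → ℝ) (γ σ : ℕ → ℝ≥0) : ℝ≥0∞ := ∑' i, ENNReal.ofReal (lam a γ σ i)

end

end LinearGaussian

/-!
The posterior and the prior are infinite products, so absolute continuity is a question of
Kakutani type. For fixed data `y` it is answered in `L²`.

Completing the square shows that the `i`-th posterior is Gaussian with density
`g_i = 𝒩(a_i u, γ_i²)(y_i) / 𝒩(0, s_i)(y_i)` with respect to the prior, where
`s_i = γ_i² + a_i² σ_i²` is the variance of `y_i`. Its second moment under the prior is at most
`exp (λ_i + λ_i z_i²)` with `z_i² = y_i² / s_i` (`integral_sq_div_gaussianPDFReal_le`).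

*Convergence.* If `∑ λ_i < ∞`, then `∑ λ_i z_i² < ∞` almost surely, because the `z_i²` have a common
finite mean. So the second moments of the partial products `∏_{i<n} g_i(u_i)` are bounded; as these
partial products form a martingale, they converge in `L²`, and their limit is the density of the
posterior (`exists_infinitePi_withDensity_eq`). Hence `ρ_∞ < ∞`.

*Divergence.* The posterior means `m_i` satisfy `m_i² / σ_i² = λ_i / (1 + λ_i) z_i²`. If their sum is
infinite, the statistics `∑_{i<n} (m_i / σ_i²) u_i` separate posterior and prior by Chebyshev's
inequality (`summable_of_infinitePi_gaussianReal_absolutelyContinuous`). So if the posterior is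
almost surely absolutely continuous, then `∑ λ_i / (1 + λ_i) z_i² < ∞` almost surely, and since the
`z_i` are identically distributed and not zero, `∑ λ_i / (1 + λ_i) < ∞`
(`tsum_lt_top_of_ae_tsum_mul_lt_top`), which is equivalent to `∑ λ_i < ∞`.
-/

namespace LinearGaussian

open Filter Topology

/-! ### Products of densities in `L²` -/

section Product

variable {E : ℕ → Type*} [∀ i, MeasurableSpace (E i)] (π : ∀ i, Measure (E i))
  [∀ i, IsProbabilityMeasure (π i)]

theorem lintegral_prod_infinitePi (s : Finset ℕ) {f : ∀ i, E i → ℝ≥0∞}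
    (hf : ∀ i, Measurable (f i)) :
    ∫⁻ ω, ∏ i ∈ s, f i (ω i) ∂(Measure.infinitePi π) = ∏ i ∈ s, ∫⁻ x, f i x ∂(π i) := by
  refine (lintegral_prod_eq_prod_lintegral_of_indepFun s (fun i (ω : ∀ i, E i) => f i (ω i))
    (iIndepFun_infinitePi hf) fun i => (hf i).comp (measurable_pi_apply i)).trans ?_
  exact Finset.prod_congr rfl fun i _ =>
    (measurePreserving_eval_infinitePi π i).lintegral_comp (hf i)

theorem integral_prod_infinitePi (s : Finset ℕ) {f : ∀ i, E i → ℝ}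
    (hf : ∀ i, Measurable (f i)) :
    ∫ ω, ∏ i ∈ s, f i (ω i) ∂(Measure.infinitePi π) = ∏ i ∈ s, ∫ x, f i x ∂(π i) := by
  have h := ((iIndepFun_infinitePi (P := π) hf).precomp
    (Subtype.val_injective (p := (· ∈ s)))).integral_fun_prod_eq_prod_integral
    (fun i => ((hf i).comp (measurable_pi_apply _)).aestronglyMeasurable)
  have h2 : ∀ ω : ∀ i, E i, ∏ i : s, f i (ω i) = ∏ i ∈ s, f i (ω i) := fun ω =>
    Finset.prod_coe_sort s (fun i => f i (ω i))
  have h3 : ∏ i : s, ∫ ω, f i (ω i) ∂(Measure.infinitePi π)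
      = ∏ i ∈ s, ∫ ω, f i (ω i) ∂(Measure.infinitePi π) :=
    Finset.prod_coe_sort s (fun i => ∫ ω, f i (ω i) ∂(Measure.infinitePi π))
  simp only [h2] at h
  rw [h, h3]
  refine Finset.prod_congr rfl fun i _ => ?_
  rw [← (measurePreserving_eval_infinitePi π i).map_eq,
    integral_map (measurable_pi_apply i).aemeasurable (hf i).aestronglyMeasurable]

variable {π} {g : ∀ i, E i → ℝ}

theorem memLp_two_prod_infinitePi (hg : ∀ i, Measurable (g i))
    (hg2 : ∀ i, Integrable (fun x => g i x ^ 2) (π i)) (s : Finset ℕ) :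
    MemLp (fun ω : ∀ i, E i => ∏ i ∈ s, g i (ω i)) 2 (Measure.infinitePi π) := by
  have hm : Measurable fun ω : ∀ i, E i => ∏ i ∈ s, g i (ω i) :=
    Finset.measurable_fun_prod _ fun i _ => (hg i).comp (measurable_pi_apply i)
  rw [memLp_two_iff_integrable_sq hm.aestronglyMeasurable]
  refine ⟨(hm.pow_const 2).aestronglyMeasurable, ?_⟩
  have h : ∀ ω : ∀ i, E i, ‖(∏ i ∈ s, g i (ω i)) ^ 2‖ₑ = ∏ i ∈ s, ‖g i (ω i) ^ 2‖ₑ := by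
    intro ω
    simp only [← ofReal_norm, ← Finset.prod_pow, norm_prod]
    exact ENNReal.ofReal_prod_of_nonneg fun i _ => norm_nonneg _
  rw [hasFiniteIntegral_iff_enorm]
  simp only [h]
  rw [lintegral_prod_infinitePi π s (f := fun i x => ‖g i x ^ 2‖ₑ)
    fun i => ((hg i).pow_const 2).enorm]
  exact ENNReal.prod_lt_top fun i _ => (hg2 i).2

/-- The partial products of normalized densities form a martingale, so their `L²` inner products
only see the shorter of the two products. -/
theorem integral_mul_prod_infinitePi (hg : ∀ i, Measurable (g i))
    (hg1 : ∀ i, ∫ x, g i x ∂(π i) = 1) {m n : ℕ} (hmn : m ≤ n) :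
    ∫ ω, (∏ i ∈ Finset.range m, g i (ω i)) * (∏ i ∈ Finset.range n, g i (ω i))
      ∂(Measure.infinitePi π) = ∏ i ∈ Finset.range m, ∫ x, g i x ^ 2 ∂(π i) := by
  have hmem : ∀ i ∈ Finset.Ico m n, ¬ i < m := fun i hi => by
    have := (Finset.mem_Ico.1 hi).1; omega
  have h : ∀ ω : ∀ i, E i, (∏ i ∈ Finset.range m, g i (ω i)) * (∏ i ∈ Finset.range n, g i (ω i))
      = ∏ i ∈ Finset.range n, (if i < m then g i (ω i) ^ 2 else g i (ω i)) := by
    intro ω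
    rw [← Finset.prod_range_mul_prod_Ico _ hmn, ← Finset.prod_range_mul_prod_Ico _ hmn,
      ← mul_assoc, ← Finset.prod_mul_distrib]
    congr 1
    · exact Finset.prod_congr rfl fun i hi => by rw [if_pos (Finset.mem_range.1 hi), sq]
    · exact Finset.prod_congr rfl fun i hi => by rw [if_neg (hmem i hi)]
  simp only [h]
  rw [integral_prod_infinitePi π _ (f := fun i x => if i < m then g i x ^ 2 else g i x)
      fun i => by split_ifs <;> [exact (hg i).pow_const 2; exact hg i],
    ← Finset.prod_range_mul_prod_Ico _ hmn]
  rw [Finset.prod_eq_one (s := Finset.Ico m n), mul_one]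
  · exact Finset.prod_congr rfl fun i hi => by simp only [if_pos (Finset.mem_range.1 hi)]
  · intro i hi
    simp only [if_neg (hmem i hi), hg1 i]

theorem setIntegral_pi_prod_infinitePi (hg : ∀ i, Measurable (g i))
    (hg1 : ∀ i, ∫ x, g i x ∂(π i) = 1) {s : Finset ℕ} {n : ℕ} (hs : s ⊆ Finset.range n)
    {t : ∀ i, Set (E i)} (ht : ∀ i, MeasurableSet (t i)) :
    ∫ ω in Set.pi s t, ∏ i ∈ Finset.range n, g i (ω i) ∂(Measure.infinitePi π)
      = ∏ i ∈ s, ∫ x in t i, g i x ∂(π i) := by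
  classical
  rw [← integral_indicator (MeasurableSet.pi (Finset.countable_toSet s) fun i _ => ht i)]
  have h : ∀ ω : ∀ i, E i,
      (Set.pi (s : Set ℕ) t).indicator (fun ω => ∏ i ∈ Finset.range n, g i (ω i)) ω
      = ∏ i ∈ Finset.range n, (if i ∈ s then (t i).indicator (g i) (ω i) else g i (ω i)) := by
    intro ω
    by_cases hω : ω ∈ Set.pi (s : Set ℕ) t
    · rw [Set.indicator_of_mem hω]
      refine Finset.prod_congr rfl fun i _ => ?_
      split_ifs with hi
      · rw [Set.indicator_of_mem (hω i hi)]
      · rfl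
    · rw [Set.indicator_of_notMem hω]
      simp only [Set.mem_pi, not_forall] at hω
      obtain ⟨i, hi, hit⟩ := hω
      refine (Finset.prod_eq_zero (hs hi) ?_).symm
      rw [if_pos (Finset.mem_coe.1 hi), Set.indicator_of_notMem hit]
  simp only [h]
  rw [integral_prod_infinitePi π _
      (f := fun i x => if i ∈ s then (t i).indicator (g i) x else g i x)
      fun i => by split_ifs <;> [exact (hg i).indicator (ht i); exact hg i],
    ← Finset.prod_subset hs]
  · refine Finset.prod_congr rfl fun i hi => ?_
    simp only [if_pos hi]
    exact integral_indicator (ht i)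
  · intro i _ hi
    simp only [if_neg hi, hg1 i]

/-- The convergent half of Kakutani's dichotomy, in its `L²` form: if the second moments of the
densities `g i` have bounded partial products, then the product of the measures `g i • π i` has a
square integrable density with respect to the product of the `π i`. -/
theorem exists_infinitePi_withDensity_eq (hg : ∀ i, Measurable (g i)) (hg0 : ∀ i x, 0 ≤ g i x)
    (hg1 : ∀ i, ∫ x, g i x ∂(π i) = 1) (hg2 : ∀ i, Integrable (fun x => g i x ^ 2) (π i))
    {C : ℝ} (hC : ∀ n, ∏ i ∈ Finset.range n, ∫ x, g i x ^ 2 ∂(π i) ≤ C)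
    (μ : ∀ i, Measure (E i)) [∀ i, IsProbabilityMeasure (μ i)]
    (hμ : ∀ i, μ i = (π i).withDensity fun x => ENNReal.ofReal (g i x)) :
    ∃ G : (∀ i, E i) → ℝ≥0∞, AEMeasurable G (Measure.infinitePi π) ∧
      ∫⁻ ω, G ω ^ 2 ∂(Measure.infinitePi π) < ∞ ∧
      Measure.infinitePi μ = (Measure.infinitePi π).withDensity G := by
  set P : ℕ → ℝ := fun n => ∏ i ∈ Finset.range n, ∫ x, g i x ^ 2 ∂(π i)
  have hgi : ∀ i, Integrable (g i) (π i) := fun i =>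
    ((memLp_two_iff_integrable_sq (hg i).aestronglyMeasurable).2 (hg2 i)).integrable one_le_two
  have hL := fun n => memLp_two_prod_infinitePi (π := π) hg hg2 (Finset.range n)
  set F : ℕ → Lp ℝ 2 (Measure.infinitePi π) := fun n => (hL n).toLp _ with hF
  have hinner : ∀ m n, m ≤ n → inner ℝ (F m) (F n) = P m := by
    intro m n hmn
    rw [L2.inner_def]
    refine Eq.trans ?_ (integral_mul_prod_infinitePi hg hg1 hmn)
    refine integral_congr_ae ?_
    filter_upwards [(hL m).coeFn_toLp, (hL n).coeFn_toLp] with ω h1 h2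
    simp only [hF, h1, h2, RCLike.inner_apply, conj_trivial]
    ring
  have hdist : ∀ m n, m ≤ n → ‖F n - F m‖ ^ 2 = P n - P m := by
    intro m n hmn
    rw [norm_sub_sq_real, ← real_inner_self_eq_norm_sq, ← real_inner_self_eq_norm_sq,
      real_inner_comm (F m) (F n), hinner m n hmn, hinner n n le_rfl, hinner m m le_rfl]
    ring
  have hmono : Monotone P := fun m n hmn => by
    have := hdist m n hmn
    nlinarith [sq_nonneg ‖F n - F m‖]
  have hPc : CauchySeq P :=
    (tendsto_atTop_ciSup hmono ⟨C, by rintro _ ⟨n, rfl⟩; exact hC n⟩).cauchySeq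
  -- squared distances are increments of the bounded monotone sequence `P`
  have hFc : CauchySeq F := by
    rw [Metric.cauchySeq_iff'] at hPc ⊢
    intro ε hε
    obtain ⟨N, hN⟩ := hPc (ε ^ 2) (by positivity)
    refine ⟨N, fun n hn => ?_⟩
    have h1 := hN n hn
    rw [Real.dist_eq, ← hdist N n hn, abs_of_nonneg (sq_nonneg _)] at h1
    rw [dist_eq_norm]
    exact lt_of_pow_lt_pow_left₀ 2 hε.le h1
  obtain ⟨G, hG⟩ := cauchySeq_tendsto_of_complete hFc
  -- integration over `A` is the inner product with an indicator, hence continuous on `L²`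
  have hset : ∀ A, MeasurableSet A → Tendsto
      (fun n => ∫ ω in A, ∏ i ∈ Finset.range n, g i (ω i) ∂(Measure.infinitePi π)) atTop
      (𝓝 (∫ ω in A, G ω ∂(Measure.infinitePi π))) := by
    intro A hA
    have h1 := (tendsto_const_nhds (x := indicatorConstLp 2 hA
      (measure_ne_top (Measure.infinitePi π) A) (1 : ℝ))).inner (𝕜 := ℝ) hG
    simp only [L2.inner_indicatorConstLp_one] at h1
    refine h1.congr fun n => ?_
    refine integral_congr_ae (ae_restrict_of_ae ?_)
    exact (hL n).coeFn_toLp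
  have hGi : Integrable G (Measure.infinitePi π) := (Lp.memLp G).integrable one_le_two
  have hG0 : 0 ≤ᵐ[Measure.infinitePi π] G :=
    ae_nonneg_of_forall_setIntegral_nonneg hGi fun A hA _ =>
      ge_of_tendsto' (hset A hA) fun n =>
        integral_nonneg fun ω => Finset.prod_nonneg fun i _ => hg0 i _
  refine ⟨fun ω => ENNReal.ofReal (G ω), hGi.1.aemeasurable.ennreal_ofReal, ?_, ?_⟩
  · have h2 := (Lp.memLp G).integrable_sq.2
    rw [hasFiniteIntegral_iff_enorm] at h2
    refine lt_of_le_of_lt (lintegral_mono fun ω => ?_) h2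
    rw [enorm_pow]
    gcongr
    exact Real.ofReal_le_enorm _
  · refine (Measure.eq_infinitePi μ fun s t ht => ?_).symm
    have hB : MeasurableSet (Set.pi (s : Set ℕ) t) :=
      MeasurableSet.pi (Finset.countable_toSet s) fun i _ => ht i
    obtain ⟨N, hN⟩ := s.exists_nat_subset_range
    have hlim := hset _ hB
    -- on a box the integrals are constant once `n` exceeds all constrained coordinates
    have hconst : Tendsto
        (fun n => ∫ ω in Set.pi s t, ∏ i ∈ Finset.range n, g i (ω i) ∂(Measure.infinitePi π)) atTop
        (𝓝 (∏ i ∈ s, ∫ x in t i, g i x ∂(π i))) := by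
      refine tendsto_const_nhds.congr' ?_
      filter_upwards [eventually_ge_atTop N] with n hn
      exact (setIntegral_pi_prod_infinitePi hg hg1
        (hN.trans (Finset.range_subset_range.2 hn)) ht).symm
    rw [withDensity_apply _ hB, ← ofReal_integral_eq_lintegral_ofReal hGi.integrableOn
      (ae_restrict_of_ae hG0), tendsto_nhds_unique hlim hconst,
      ENNReal.ofReal_prod_of_nonneg fun i _ => integral_nonneg (hg0 i)]
    refine Finset.prod_congr rfl fun i _ => ?_
    rw [hμ i, withDensity_apply _ (ht i), ofReal_integral_eq_lintegral_ofReal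
      (hgi i).integrableOn (Eventually.of_forall (hg0 i))]

end Product

/-! ### Scalar Gaussian computations -/

section Scalar

theorem coe_add_nnnorm_sq_mul (w v : ℝ≥0) (a : ℝ) :
    ((w + ‖a‖₊ ^ 2 * v : ℝ≥0) : ℝ) = w + a ^ 2 * v := by
  push_cast
  rw [Real.norm_eq_abs, sq_abs]

variable {a : ℝ} {v w s : ℝ≥0}

/-- Completing the square: the joint density of unknown and datum, factored the other way round. -/
theorem gaussianPDFReal_mul_gaussianPDFReal (hv : 0 < v) (hw : 0 < w)
    (hs : (s : ℝ) = w + a ^ 2 * v) (y u : ℝ) :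
    gaussianPDFReal (a * u) w y * gaussianPDFReal 0 v u
      = gaussianPDFReal 0 s y * gaussianPDFReal (a * v * y / s) (v * w / s) u := by
  have hv' : (0 : ℝ) < v := hv
  have hw' : (0 : ℝ) < w := hw
  have hs' : (0 : ℝ) < s := by rw [hs]; positivity
  have h1 : (√(2 * Real.pi * w))⁻¹ * (√(2 * Real.pi * v))⁻¹
      = (√(2 * Real.pi * s))⁻¹ * (√(2 * Real.pi * (v * w / s : ℝ≥0)))⁻¹ := by
    rw [← mul_inv, ← mul_inv, ← Real.sqrt_mul (by positivity), ← Real.sqrt_mul (by positivity)]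
    push_cast
    congr 2
    field_simp
  have h2 : -(y - a * u) ^ 2 / (2 * w) + -(u - 0) ^ 2 / (2 * v)
      = -(y - 0) ^ 2 / (2 * s) + -(u - a * v * y / s) ^ 2 / (2 * (v * w / s : ℝ≥0)) := by
    push_cast
    field_simp
    rw [hs]
    ring
  simp only [gaussianPDFReal]
  rw [mul_mul_mul_comm, h1, ← Real.exp_add, h2, Real.exp_add, mul_mul_mul_comm]

theorem gaussianPDF_mul_gaussianPDF (hv : 0 < v) (hw : 0 < w)
    (hs : (s : ℝ) = w + a ^ 2 * v) (y u : ℝ) :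
    gaussianPDF (a * u) w y * gaussianPDF 0 v u
      = gaussianPDF 0 s y * gaussianPDF (a * v * y / s) (v * w / s) u := by
  simp only [gaussianPDF]
  rw [← ENNReal.ofReal_mul (gaussianPDFReal_nonneg _ _ _),
    ← ENNReal.ofReal_mul (gaussianPDFReal_nonneg _ _ _),
    gaussianPDFReal_mul_gaussianPDFReal hv hw hs]

theorem measurable_gaussianPDFReal_mean (a : ℝ) (w : ℝ≥0) (y : ℝ) :
    Measurable fun u => gaussianPDFReal (a * u) w y := by
  unfold gaussianPDFReal
  fun_prop

theorem measurable_gaussianPDF_mean (a : ℝ) (w : ℝ≥0) (y : ℝ) :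
    Measurable fun u => gaussianPDF (a * u) w y :=
  (measurable_gaussianPDFReal_mean a w y).ennreal_ofReal

theorem pos_of_eq_add (hw : 0 < w) (hs : (s : ℝ) = w + a ^ 2 * v) : 0 < s := by
  have hw' : (0 : ℝ) < w := hw
  have : (0 : ℝ) < s := by rw [hs]; positivity
  exact this

theorem withDensity_gaussianPDF_mean (hv : 0 < v) (hw : 0 < w)
    (hs : (s : ℝ) = w + a ^ 2 * v) (y : ℝ) :
    (gaussianReal 0 v).withDensity (fun u => gaussianPDF (a * u) w y)
      = gaussianPDF 0 s y • gaussianReal (a * v * y / s) (v * w / s) := by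
  have hs' := pos_of_eq_add hw hs
  have hc : v * w / s ≠ 0 := (div_pos (mul_pos hv hw) hs').ne'
  rw [gaussianReal_of_var_ne_zero _ hv.ne', gaussianReal_of_var_ne_zero _ hc,
    ← withDensity_mul _ (measurable_gaussianPDF _ _) (measurable_gaussianPDF_mean a w y),
    ← withDensity_smul _ (measurable_gaussianPDF _ _)]
  congr 1
  ext u
  simp only [Pi.mul_apply, Pi.smul_apply, smul_eq_mul]
  rw [mul_comm, gaussianPDF_mul_gaussianPDF hv hw hs]

theorem lintegral_gaussianPDF_mean (hv : 0 < v) (hw : 0 < w)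
    (hs : (s : ℝ) = w + a ^ 2 * v) (y : ℝ) :
    ∫⁻ u, gaussianPDF (a * u) w y ∂(gaussianReal 0 v) = gaussianPDF 0 s y := by
  have h := congrArg (fun μ => μ Set.univ) (withDensity_gaussianPDF_mean hv hw hs y)
  simpa [withDensity_apply] using h

theorem integrable_gaussianPDFReal_mean (hv : 0 < v) (hw : 0 < w) (a y : ℝ) :
    Integrable (fun u => gaussianPDFReal (a * u) w y) (gaussianReal 0 v) := by
  refine ⟨(measurable_gaussianPDFReal_mean a w y).aestronglyMeasurable, ?_⟩
  rw [hasFiniteIntegral_iff_ofReal (Eventually.of_forall fun u => gaussianPDFReal_nonneg _ _ _)]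
  have := lintegral_gaussianPDF_mean (s := w + ‖a‖₊ ^ 2 * v) hv hw
    (coe_add_nnnorm_sq_mul w v a) y
  simp only [gaussianPDF] at this
  rw [this]
  exact ENNReal.ofReal_lt_top

theorem integral_gaussianPDFReal_mean (hv : 0 < v) (hw : 0 < w)
    (hs : (s : ℝ) = w + a ^ 2 * v) (y : ℝ) :
    ∫ u, gaussianPDFReal (a * u) w y ∂(gaussianReal 0 v) = gaussianPDFReal 0 s y := by
  rw [integral_eq_lintegral_of_nonneg_ae
    (Eventually.of_forall fun u => gaussianPDFReal_nonneg _ _ _)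
    (measurable_gaussianPDFReal_mean a w y).aestronglyMeasurable]
  have := lintegral_gaussianPDF_mean hv hw hs y
  simp only [gaussianPDF] at this
  rw [this, ENNReal.toReal_ofReal (gaussianPDFReal_nonneg _ _ _)]

/-- The square of a Gaussian density is, up to a constant, the Gaussian density of half the
variance; so second moments of likelihoods reduce to evidences. -/
theorem gaussianPDFReal_sq (m : ℝ) (hw : 0 < w) (y : ℝ) :
    gaussianPDFReal m w y ^ 2 = (2 * √(Real.pi * w))⁻¹ * gaussianPDFReal m (w / 2) y := by
  have hw' : (0 : ℝ) < w := hw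
  simp only [gaussianPDFReal]
  rw [mul_pow, inv_pow, Real.sq_sqrt (by positivity), ← Real.exp_nat_mul, ← mul_assoc]
  congr 1
  · push_cast
    rw [show 2 * Real.pi * ((w : ℝ) / 2) = Real.pi * w by ring, ← mul_inv, mul_assoc 2 (√_),
      Real.mul_self_sqrt (by positivity)]
    ring
  · push_cast
    congr 1
    field_simp

/-- The second moment of the normalized likelihood under the prior has a closed form, which is
bounded here by an exponential; the exponent is linear in `λ = a² v / w` and in `λ y² / s`. -/
theorem integral_sq_div_gaussianPDFReal_le (hv : 0 < v) (hw : 0 < w)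
    (hs : (s : ℝ) = w + a ^ 2 * v) (y : ℝ) :
    ∫ u, (gaussianPDFReal (a * u) w y / gaussianPDFReal 0 s y) ^ 2 ∂(gaussianReal 0 v)
      ≤ Real.exp (a ^ 2 * v / w + a ^ 2 * v / w * (y ^ 2 / s)) := by
  have hv' : (0 : ℝ) < v := hv
  have hw' : (0 : ℝ) < w := hw
  have hs' : 0 < s := pos_of_eq_add hw hs
  have hs'' : (0 : ℝ) < s := hs'
  have hw2 : 0 < w / 2 := half_pos hw
  set q : ℝ := w + 2 * (a ^ 2 * v) with hq
  have hq' : 0 < q := by positivity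
  simp only [div_pow, gaussianPDFReal_sq _ hw]
  rw [integral_div, integral_const_mul, integral_gaussianPDFReal_mean
    (s := w / 2 + ‖a‖₊ ^ 2 * v) hv hw2 (coe_add_nnnorm_sq_mul _ v a), gaussianPDFReal_sq _ hs']
  have h2 : (2 * √(Real.pi * s))⁻¹ * gaussianPDFReal 0 (s / 2) y
      = (2 * Real.pi * s)⁻¹ * Real.exp (-(y ^ 2 / s)) := by
    simp only [gaussianPDFReal]
    push_cast
    rw [show 2 * Real.pi * ((s : ℝ) / 2) = Real.pi * s by ring, ← mul_assoc, ← mul_inv,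
      mul_assoc 2 (√_), Real.mul_self_sqrt (by positivity), sub_zero, neg_div]
    congr 2
    · ring
    · field_simp
  have h3 : gaussianPDFReal 0 (w / 2 + ‖a‖₊ ^ 2 * v) y
      = (√(Real.pi * q))⁻¹ * Real.exp (-(y ^ 2 / q)) := by
    have h4 : 2 * ((w / 2 + ‖a‖₊ ^ 2 * v : ℝ≥0) : ℝ) = q := by
      rw [coe_add_nnnorm_sq_mul, hq]
      push_cast
      ring
    simp only [gaussianPDFReal]
    rw [mul_right_comm, h4, mul_comm q, sub_zero, neg_div]
  rw [h2, h3]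
  have h5 : (2 * √(Real.pi * w))⁻¹ * ((√(Real.pi * q))⁻¹ * Real.exp (-(y ^ 2 / q)))
      / ((2 * Real.pi * s)⁻¹ * Real.exp (-(y ^ 2 / s)))
      = s / √(w * q) * Real.exp (y ^ 2 / s - y ^ 2 / q) := by
    have h6 : √(Real.pi * w) * √(Real.pi * q) = Real.pi * √(w * q) := by
      rw [← Real.sqrt_mul (by positivity),
        show Real.pi * w * (Real.pi * q) = Real.pi ^ 2 * (w * q) by ring,
        Real.sqrt_mul (by positivity), Real.sqrt_sq Real.pi_pos.le]
    rw [sub_eq_add_neg, Real.exp_add, Real.exp_neg (y ^ 2 / s), ← mul_assoc, ← mul_inv, mul_assoc 2,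
      h6]
    have : 0 < √(w * q) := by positivity
    field_simp
  rw [h5, Real.exp_add]
  refine mul_le_mul ?_ ?_ (Real.exp_pos _).le (Real.exp_pos _).le
  · calc (s : ℝ) / √(w * q) ≤ s / w := by
          refine div_le_div_of_nonneg_left hs''.le hw' (Real.le_sqrt_of_sq_le ?_)
          rw [sq]
          refine mul_le_mul_of_nonneg_left ?_ hw'.le
          rw [hq]
          have : 0 ≤ a ^ 2 * v := by positivity
          linarith
      _ = a ^ 2 * v / w + 1 := by rw [hs]; field_simp; ring
      _ ≤ _ := Real.add_one_le_exp _
  · rw [Real.exp_le_exp]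
    have h7 : y ^ 2 / s - y ^ 2 / q = a ^ 2 * v / q * (y ^ 2 / s) := by
      field_simp
      rw [hq, hs]
      ring
    rw [h7]
    refine mul_le_mul_of_nonneg_right ?_ (by positivity)
    refine div_le_div_of_nonneg_left (by positivity) hw' ?_
    rw [hq]
    have : 0 ≤ a ^ 2 * v := by positivity
    linarith

end Scalar

/-! ### Separating Gaussian products -/

section Singular

/-- A sequence of statistics whose mean under `μ` outgrows its fluctuations under `μ` and `π`, while
it stays centred under `π`, tells the two measures apart. -/
theorem not_absolutelyContinuous_of_tendsto_mean {Ω : Type*} [MeasurableSpace Ω] {μ π : Measure Ω}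
    [IsProbabilityMeasure μ] [IsProbabilityMeasure π] {S : ℕ → Ω → ℝ} {T : ℕ → ℝ}
    (hT : Tendsto T atTop atTop) (hμ : ∀ n, MemLp (S n) 2 μ) (hπ : ∀ n, MemLp (S n) 2 π)
    (hμm : ∀ n, ∫ ω, S n ω ∂μ = T n) (hπm : ∀ n, ∫ ω, S n ω ∂π = 0)
    (hμv : ∀ n, Var[S n; μ] ≤ T n) (hπv : ∀ n, Var[S n; π] ≤ T n) : ¬ μ ≪ π := by
  intro hac
  -- a subsequence along which the Chebyshev bounds `4 / T` are summable
  have hN : ∀ k : ℕ, ∃ N, 4 * 2 ^ k ≤ T N := fun k =>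
    (hT.eventually (eventually_ge_atTop _)).exists
  choose N hN using hN
  have cheb : ∀ {ν : Measure Ω} [IsProbabilityMeasure ν] (k : ℕ), MemLp (S (N k)) 2 ν →
      Var[S (N k); ν] ≤ T (N k) →
      ν {ω | T (N k) / 2 ≤ |S (N k) ω - ∫ ω, S (N k) ω ∂ν|} ≤ ENNReal.ofReal ((1 / 2) ^ k) := by
    intro ν _ k h2 hv
    have hpos : (0 : ℝ) < 2 ^ k := by positivity
    have hTk : 0 < T (N k) := lt_of_lt_of_le (by positivity) (hN k)
    refine (meas_ge_le_variance_div_sq h2 (half_pos hTk)).trans (ENNReal.ofReal_le_ofReal ?_)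
    rw [div_pow 1, one_pow, div_le_div_iff₀ (by positivity) hpos]
    nlinarith [hN k, mul_le_mul_of_nonneg_right hv hpos.le]
  have hsum : ∑' k : ℕ, ENNReal.ofReal ((1 / 2) ^ k) ≠ ∞ :=
    (summable_geometric_of_lt_one (by norm_num) (by norm_num)).tsum_ofReal_ne_top
  have h1 : ∀ᵐ ω ∂μ, ∀ᶠ k in atTop,
      ω ∉ {ω | T (N k) / 2 ≤ |S (N k) ω - ∫ ω, S (N k) ω ∂π|} :=
    hac.ae_le <| ae_eventually_notMem <| ne_top_of_le_ne_top hsum <|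
    ENNReal.tsum_le_tsum fun k => cheb (ν := π) k (hπ _) (hπv _)
  have h2 := ae_eventually_notMem <| ne_top_of_le_ne_top hsum <|
    ENNReal.tsum_le_tsum fun k => cheb (ν := μ) k (hμ _) (hμv _)
  obtain ⟨ω, hω1, hω2⟩ := (h1.and h2).exists
  obtain ⟨k, hk1, hk2⟩ := (hω1.and hω2).exists
  simp only [hπm, hμm, Set.mem_ofPred_eq, not_le, sub_zero, abs_lt] at hk1 hk2
  linarith [hk1.2, hk2.1]

variable (k m : ℕ → ℝ) (c : ℕ → ℝ≥0)

theorem memLp_eval_infinitePi_gaussianReal (i : ℕ) :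
    MemLp (fun ω : ℕ → ℝ => ω i) 2 (Measure.infinitePi fun i => gaussianReal (m i) (c i)) :=
  (memLp_id_gaussianReal 2).comp_measurePreserving
    (measurePreserving_eval_infinitePi (fun i => gaussianReal (m i) (c i)) i)

theorem memLp_linear_infinitePi_gaussianReal (n : ℕ) :
    MemLp (fun ω : ℕ → ℝ => ∑ i ∈ Finset.range n, k i * ω i) 2
      (Measure.infinitePi fun i => gaussianReal (m i) (c i)) :=
  memLp_finsetSum _ fun i _ => (memLp_eval_infinitePi_gaussianReal m c i).const_mul (k i)

theorem integral_linear_infinitePi_gaussianReal (n : ℕ) :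
    ∫ ω, ∑ i ∈ Finset.range n, k i * ω i ∂(Measure.infinitePi fun i => gaussianReal (m i) (c i))
      = ∑ i ∈ Finset.range n, k i * m i := by
  rw [integral_finsetSum _ fun i _ =>
    ((memLp_eval_infinitePi_gaussianReal m c i).const_mul (k i)).integrable one_le_two]
  refine Finset.sum_congr rfl fun i _ => ?_
  rw [integral_const_mul]
  congr 1
  have h := integral_map (μ := Measure.infinitePi fun i => gaussianReal (m i) (c i))
    (measurable_pi_apply i).aemeasurable (f := fun x : ℝ => x) aestronglyMeasurable_id
  rw [Measure.infinitePi_map_eval, integral_id_gaussianReal] at h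
  exact h.symm

theorem variance_linear_infinitePi_gaussianReal (n : ℕ) :
    Var[fun ω : ℕ → ℝ => ∑ i ∈ Finset.range n, k i * ω i;
      Measure.infinitePi fun i => gaussianReal (m i) (c i)]
      = ∑ i ∈ Finset.range n, k i ^ 2 * c i := by
  have hind := iIndepFun_infinitePi (P := fun i => gaussianReal (m i) (c i))
    (X := fun i x => k i * x) (fun i => measurable_const_mul (k i))
  have h := IndepFun.variance_sum (s := Finset.range n)
    (X := fun i (ω : ℕ → ℝ) => k i * ω i)
    (μ := Measure.infinitePi fun i => gaussianReal (m i) (c i))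
    (fun i _ => (memLp_eval_infinitePi_gaussianReal m c i).const_mul (k i))
    (fun i _ j _ hij => hind.indepFun hij)
  rw [Finset.sum_fn] at h
  rw [h]
  refine Finset.sum_congr rfl fun i _ => ?_
  rw [variance_const_mul]
  congr 1
  have h := variance_map (μ := Measure.infinitePi fun i => gaussianReal (m i) (c i))
    (X := fun x : ℝ => x) (Y := fun ω : ℕ → ℝ => ω i) aemeasurable_id
    (measurable_pi_apply i).aemeasurable
  rw [Measure.infinitePi_map_eval, variance_fun_id_gaussianReal] at h
  exact h.symm

variable {m c} {v : ℕ → ℝ≥0}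

/-- The divergent half of Kakutani's dichotomy for Gaussian products, witnessed by the statistics
`∑ i < n, (m i / v i) ω i`: their mean under the first product is `∑ i < n, m i ^ 2 / v i`, which
also bounds their variance under both. -/
theorem summable_of_infinitePi_gaussianReal_absolutelyContinuous (hv : ∀ i, 0 < v i)
    (hcv : ∀ i, c i ≤ v i)
    (hac : (Measure.infinitePi fun i => gaussianReal (m i) (c i)) ≪
      Measure.infinitePi fun i => gaussianReal 0 (v i)) :
    Summable fun i => m i ^ 2 / v i := by
  by_contra hs
  rw [not_summable_iff_tendsto_nat_atTop_of_nonneg fun i => by positivity] at hs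
  refine not_absolutelyContinuous_of_tendsto_mean hs
    (memLp_linear_infinitePi_gaussianReal (fun i => m i / v i) m c)
    (memLp_linear_infinitePi_gaussianReal (fun i => m i / v i) (fun _ => 0) v)
    (fun n => ?_) (fun n => ?_) (fun n => ?_) (fun n => ?_) hac
  · rw [integral_linear_infinitePi_gaussianReal]
    exact Finset.sum_congr rfl fun i _ => by ring
  · simp [integral_linear_infinitePi_gaussianReal]
  · rw [variance_linear_infinitePi_gaussianReal]
    refine Finset.sum_le_sum fun i _ => ?_
    have hvi : (0 : ℝ) < v i := hv i
    calc (m i / v i) ^ 2 * (c i : ℝ) ≤ (m i / v i) ^ 2 * v i :=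
          mul_le_mul_of_nonneg_left (hcv i) (sq_nonneg _)
      _ = m i ^ 2 / v i := by field_simp
  · rw [variance_linear_infinitePi_gaussianReal]
    refine (Finset.sum_congr rfl fun i _ => ?_).le
    have hvi : (0 : ℝ) < v i := hv i
    field_simp

end Singular

/-! ### Almost sure convergence of weighted series -/

section Series

/-- If a weighted series of random variables converges almost surely, and each of them is at least
`1` with a probability bounded below, then the weights are summable. No independence is needed:
the sum is bounded on an event so large that every term keeps a fixed part of its mass there. -/
theorem tsum_lt_top_of_ae_tsum_mul_lt_top {Ω : Type*} [MeasurableSpace Ω] {ν : Measure Ω}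
    [IsFiniteMeasure ν] {Z : ℕ → Ω → ℝ≥0∞} (hZ : ∀ i, Measurable (Z i)) {q : ℝ≥0∞} (hq : q ≠ 0)
    (hqZ : ∀ i, q ≤ ν {ω | 1 ≤ Z i ω}) (r : ℕ → ℝ≥0∞)
    (h : ∀ᵐ ω ∂ν, ∑' i, r i * Z i ω < ∞) : ∑' i, r i < ∞ := by
  set S : Ω → ℝ≥0∞ := fun ω => ∑' i, r i * Z i ω with hS
  have hSm : Measurable S := Measurable.tsum fun i => (hZ i).const_mul (r i)
  have hqt : q ≠ ∞ := ne_top_of_le_ne_top (measure_ne_top ν _) (hqZ 0)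
  have hmeas : ∀ M : ℕ, MeasurableSet {ω | (M : ℝ≥0∞) < S ω} := fun M =>
    measurableSet_lt measurable_const hSm
  have hlim := tendsto_measure_iInter_atTop (μ := ν) (s := fun M : ℕ => {ω | (M : ℝ≥0∞) < S ω})
    (fun M => (hmeas M).nullMeasurableSet)
    (fun M M' hM ω (hω : (M' : ℝ≥0∞) < S ω) =>
      lt_of_le_of_lt (Nat.cast_le.2 hM : (M : ℝ≥0∞) ≤ M') hω)
    ⟨0, measure_ne_top _ _⟩
  have hzero : ν (⋂ M : ℕ, {ω | (M : ℝ≥0∞) < S ω}) = 0 := by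
    refine measure_mono_null (fun ω hω => ?_) (ae_iff.1 h)
    simp only [Set.mem_iInter, Set.mem_ofPred_eq] at hω ⊢
    intro hlt
    obtain ⟨M, hM⟩ := ENNReal.exists_nat_gt hlt.ne
    exact lt_asymm hM (hω M)
  rw [hzero] at hlim
  obtain ⟨M, hM⟩ := (hlim.eventually (gt_mem_nhds (ENNReal.half_pos hq))).exists
  simp only [Function.comp] at hM
  -- on `B` the sum is bounded, and the complement of `B` has measure less than `q / 2`
  set B : Set Ω := {ω | S ω ≤ M} with hB
  have hBm : MeasurableSet B := measurableSet_le hSm measurable_const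
  have hBZ : ∀ i, q / 2 ≤ ∫⁻ ω in B, Z i ω ∂ν := by
    intro i
    have hAm : MeasurableSet {ω | 1 ≤ Z i ω} := measurableSet_le measurable_const (hZ i)
    have h1 : q ≤ ν (B ∩ {ω | 1 ≤ Z i ω}) + q / 2 := by
      refine (hqZ i).trans ((measure_mono (t := (B ∩ {ω | 1 ≤ Z i ω}) ∪ {ω | (M : ℝ≥0∞) < S ω})
        fun ω hω => ?_).trans ((measure_union_le _ _).trans (add_le_add le_rfl hM.le)))
      rcases le_or_gt (S ω) M with hle | hgt
      · exact Or.inl ⟨hle, hω⟩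
      · exact Or.inr hgt
    have h2 : q / 2 ≤ ν (B ∩ {ω | 1 ≤ Z i ω}) := by
      have h3 : q / 2 + q / 2 ≤ ν (B ∩ {ω | 1 ≤ Z i ω}) + q / 2 := by
        rwa [ENNReal.add_halves]
      exact (ENNReal.add_le_add_iff_right (ENNReal.div_ne_top hqt two_ne_zero)).1 h3
    refine h2.trans ?_
    have h4 := mul_meas_ge_le_lintegral (μ := ν.restrict B) (hZ i) 1
    rwa [one_mul, Measure.restrict_apply hAm, Set.inter_comm] at h4
  have hbound : (∑' i, r i) * (q / 2) ≤ M * ν B := by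
    calc (∑' i, r i) * (q / 2) = ∑' i, r i * (q / 2) := ENNReal.tsum_mul_right.symm
      _ ≤ ∑' i, r i * ∫⁻ ω in B, Z i ω ∂ν :=
          ENNReal.tsum_le_tsum fun i => mul_le_mul_right (hBZ i) _
      _ = ∫⁻ ω in B, S ω ∂ν := by
          rw [hS, lintegral_tsum fun i => ((hZ i).const_mul (r i)).aemeasurable]
          exact tsum_congr fun i => (lintegral_const_mul _ (hZ i)).symm
      _ ≤ ∫⁻ _ in B, M ∂ν := setLIntegral_mono measurable_const fun ω hω => hω
      _ = M * ν B := by simp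
  by_contra htop
  rw [not_lt, top_le_iff] at htop
  rw [htop, ENNReal.top_mul (ENNReal.half_pos hq).ne', top_le_iff] at hbound
  exact ENNReal.mul_ne_top (ENNReal.natCast_ne_top M) (measure_ne_top ν B) hbound

/-- The weights `x / (1 + x)` are summable only if the `x` are. -/
theorem summable_of_summable_div_one_add {x : ℕ → ℝ} (hx : ∀ i, 0 ≤ x i)
    (h : Summable fun i => x i / (1 + x i)) : Summable x := by
  refine Summable.of_norm_bounded_eventually_nat (h.mul_left 2) ?_
  filter_upwards [h.tendsto_atTop_zero.eventually (gt_mem_nhds (half_pos one_pos))] with i hi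
  have h1 : 0 < 1 + x i := by linarith [hx i]
  rw [Real.norm_of_nonneg (hx i), ← mul_div_assoc, le_div_iff₀ h1]
  rw [div_lt_div_iff₀ h1 two_pos] at hi
  nlinarith [hx i]

end Series

/-! ### The inverse problem -/

section Model

/-- The variance `γ² + a² σ²` of the datum `y = a u + η`. -/
noncomputable def dataVar (a : ℝ) (γ σ : ℝ≥0) : ℝ≥0 := γ ^ 2 + ‖a‖₊ ^ 2 * σ ^ 2

theorem coe_dataVar (a : ℝ) (γ σ : ℝ≥0) :
    (dataVar a γ σ : ℝ) = (γ ^ 2 : ℝ≥0) + a ^ 2 * (σ ^ 2 : ℝ≥0) :=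
  coe_add_nnnorm_sq_mul _ _ _

theorem evidenceOne_eq (a : ℝ) {γ σ : ℝ≥0} (hγ : 0 < γ) (hσ : 0 < σ) (y : ℝ) :
    evidenceOne a γ σ y = gaussianPDF 0 (dataVar a γ σ) y :=
  lintegral_gaussianPDF_mean (pow_pos hσ 2) (pow_pos hγ 2) (coe_dataVar a γ σ) y

/-- Conjugacy: the scalar posterior is Gaussian. -/
theorem posteriorOne_eq_gaussianReal (a : ℝ) {γ σ : ℝ≥0} (hγ : 0 < γ) (hσ : 0 < σ) (y : ℝ) :
    posteriorOne a γ σ y = gaussianReal (a * (σ ^ 2 : ℝ≥0) * y / dataVar a γ σ)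
      (σ ^ 2 * γ ^ 2 / dataVar a γ σ) := by
  have hs := pos_of_eq_add (pow_pos hγ 2) (coe_dataVar a γ σ)
  unfold posteriorOne likelihoodOne priorOne
  rw [evidenceOne_eq a hγ hσ, withDensity_gaussianPDF_mean (pow_pos hσ 2) (pow_pos hγ 2)
    (coe_dataVar a γ σ), smul_smul, ENNReal.inv_mul_cancel (gaussianPDF_pos _ hs.ne' _).ne'
    gaussianPDF_ne_top, one_smul]

theorem posteriorOne_eq_withDensity (a : ℝ) {γ σ : ℝ≥0} (hγ : 0 < γ) (hσ : 0 < σ) (y : ℝ) :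
    posteriorOne a γ σ y = (priorOne σ).withDensity fun u => ENNReal.ofReal
      (gaussianPDFReal (a * u) (γ ^ 2) y / gaussianPDFReal 0 (dataVar a γ σ) y) := by
  have hs := pos_of_eq_add (pow_pos hγ 2) (coe_dataVar a γ σ)
  unfold posteriorOne
  rw [evidenceOne_eq a hγ hσ, ← withDensity_smul _ (measurable_likelihoodOne a γ y)]
  congr 1
  ext u
  rw [ENNReal.ofReal_div_of_pos (gaussianPDFReal_pos _ _ _ hs.ne'), ENNReal.div_eq_inv_mul]
  rfl

theorem lam_eq (a : ℕ → ℝ) (γ σ : ℕ → ℝ≥0) (i : ℕ) :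
    lam a γ σ i = a i ^ 2 * ((σ i) ^ 2 : ℝ≥0) / ((γ i) ^ 2 : ℝ≥0) := by
  simp [lam]

theorem lam_nonneg (a : ℕ → ℝ) (γ σ : ℕ → ℝ≥0) (i : ℕ) : 0 ≤ lam a γ σ i := by
  unfold lam
  positivity

theorem tau_lt_top_iff (a : ℕ → ℝ) (γ σ : ℕ → ℝ≥0) :
    tau a γ σ < ∞ ↔ Summable (lam a γ σ) := by
  refine ⟨fun h => ?_, fun h => h.tsum_ofReal_lt_top⟩
  refine (ENNReal.summable_toReal h.ne).congr fun i => ?_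
  exact ENNReal.toReal_ofReal (lam_nonneg a γ σ i)

instance (σ : ℝ≥0) : IsProbabilityMeasure (priorOne σ) :=
  inferInstanceAs (IsProbabilityMeasure (gaussianReal 0 (σ ^ 2)))

instance (σ : ℕ → ℝ≥0) : IsProbabilityMeasure (priorInf σ) :=
  inferInstanceAs (IsProbabilityMeasure (Measure.infinitePi fun i => priorOne (σ i)))

instance (γ : ℕ → ℝ≥0) : IsProbabilityMeasure (noise γ) :=
  inferInstanceAs (IsProbabilityMeasure (Measure.infinitePi fun i => gaussianReal 0 ((γ i) ^ 2)))

theorem measurable_data (a : ℕ → ℝ) :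
    Measurable fun (p : (ℕ → ℝ) × (ℕ → ℝ)) i => a i * p.1 i + p.2 i := by
  fun_prop

instance (a : ℕ → ℝ) (γ σ : ℕ → ℝ≥0) : IsProbabilityMeasure (dataLaw a γ σ) :=
  Measure.isProbabilityMeasure_map (measurable_data a).aemeasurable

theorem dataLaw_map_eval (a : ℕ → ℝ) (γ σ : ℕ → ℝ≥0) (i : ℕ) :
    (dataLaw a γ σ).map (fun y => y i) = gaussianReal 0 (dataVar (a i) (γ i) (σ i)) := by
  have hX : ((priorInf σ).prod (noise γ)).map (fun p => a i * p.1 i)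
      = gaussianReal 0 (‖a i‖₊ ^ 2 * (σ i) ^ 2) := by
    rw [show (fun p : (ℕ → ℝ) × (ℕ → ℝ) => a i * p.1 i)
        = (a i * ·) ∘ (fun u : ℕ → ℝ => u i) ∘ Prod.fst from rfl,
      ← Measure.map_map (by fun_prop) (by fun_prop), ← Measure.map_map (by fun_prop) (by fun_prop),
      measurePreserving_fst.map_eq, priorInf, Measure.infinitePi_map_eval, priorOne,
      gaussianReal_map_const_mul, mul_zero]
    congr 2
    ext
    simp
  have hY : ((priorInf σ).prod (noise γ)).map (fun p => p.2 i) = gaussianReal 0 ((γ i) ^ 2) := by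
    rw [show (fun p : (ℕ → ℝ) × (ℕ → ℝ) => p.2 i)
        = (fun u : ℕ → ℝ => u i) ∘ Prod.snd from rfl,
      ← Measure.map_map (by fun_prop) (by fun_prop),
      measurePreserving_snd.map_eq, noise, Measure.infinitePi_map_eval]
  have hXY : IndepFun (fun p : (ℕ → ℝ) × (ℕ → ℝ) => a i * p.1 i) (fun p => p.2 i)
      ((priorInf σ).prod (noise γ)) :=
    indepFun_prod (X := fun u : ℕ → ℝ => a i * u i) (Y := fun u : ℕ → ℝ => u i)
      (by fun_prop) (by fun_prop)
  have h := gaussianReal_add_gaussianReal_of_indepFun hXY hX hY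
  rw [add_zero, add_comm (‖a i‖₊ ^ 2 * _)] at h
  rw [dataLaw, Measure.map_map (measurable_pi_apply i) (measurable_data a), dataVar, ← h]
  rfl

/-- The squared standardized datum `y_i² / (γ_i² + a_i² σ_i²)`. -/
noncomputable def stdDatumSq (a : ℕ → ℝ) (γ σ : ℕ → ℝ≥0) (i : ℕ) (y : ℕ → ℝ) : ℝ≥0∞ :=
  ENNReal.ofReal ((y i) ^ 2 / dataVar (a i) (γ i) (σ i))

theorem measurable_stdDatumSq (a : ℕ → ℝ) (γ σ : ℕ → ℝ≥0) (i : ℕ) :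
    Measurable (stdDatumSq a γ σ i) := by
  unfold stdDatumSq
  fun_prop

theorem dataLaw_map_stdDatumSq (a : ℕ → ℝ) (γ σ : ℕ → ℝ≥0) (hγ : ∀ i, 0 < γ i) (i : ℕ) :
    (dataLaw a γ σ).map (stdDatumSq a γ σ i)
      = (gaussianReal 0 1).map fun x => ENNReal.ofReal (x ^ 2) := by
  have hs := pos_of_eq_add (pow_pos (hγ i) 2) (coe_dataVar (a i) (γ i) (σ i))
  set s := dataVar (a i) (γ i) (σ i) with hs_def
  have h1 : (gaussianReal 0 s).map (· / √(s : ℝ)) = gaussianReal 0 1 := by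
    rw [gaussianReal_map_div_const, zero_div]
    congr 1
    ext
    rw [NNReal.coe_div, NNReal.coe_mk, Real.sq_sqrt s.coe_nonneg, NNReal.coe_one]
    exact div_self (NNReal.coe_ne_zero.2 hs.ne')
  rw [← h1, ← dataLaw_map_eval, Measure.map_map (by fun_prop) (by fun_prop),
    Measure.map_map (by fun_prop) (by fun_prop)]
  congr 1
  ext y
  simp only [Function.comp, stdDatumSq, div_pow, Real.sq_sqrt s.coe_nonneg, ← hs_def]

theorem lintegral_stdDatumSq (a : ℕ → ℝ) (γ σ : ℕ → ℝ≥0) (hγ : ∀ i, 0 < γ i) (i : ℕ) :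
    ∫⁻ y, stdDatumSq a γ σ i y ∂(dataLaw a γ σ)
      = ∫⁻ x, ENNReal.ofReal (x ^ 2) ∂(gaussianReal 0 1) := by
  have h1 := lintegral_map (μ := dataLaw a γ σ) measurable_id (measurable_stdDatumSq a γ σ i)
  have h2 := lintegral_map (μ := gaussianReal 0 1) (g := fun x : ℝ => ENNReal.ofReal (x ^ 2))
    measurable_id (by fun_prop)
  rw [dataLaw_map_stdDatumSq a γ σ hγ i] at h1
  exact h1.symm.trans h2

theorem measure_one_le_stdDatumSq (a : ℕ → ℝ) (γ σ : ℕ → ℝ≥0) (hγ : ∀ i, 0 < γ i) (i : ℕ) :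
    dataLaw a γ σ {y | 1 ≤ stdDatumSq a γ σ i y}
      = gaussianReal 0 1 {x | 1 ≤ ENNReal.ofReal (x ^ 2)} := by
  have h := congrArg (fun μ => μ (Set.Ici 1)) (dataLaw_map_stdDatumSq a γ σ hγ i)
  rwa [Measure.map_apply (measurable_stdDatumSq a γ σ i) measurableSet_Ici,
    Measure.map_apply (by fun_prop) measurableSet_Ici] at h

theorem gaussianReal_one_le_sq_ne_zero :
    gaussianReal 0 1 {x | 1 ≤ ENNReal.ofReal (x ^ 2)} ≠ 0 := by
  intro h
  have h1 := gaussianReal_absolutelyContinuous' 0 one_ne_zero h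
  have h2 : volume (Set.Icc (1 : ℝ) 2) = 0 := by
    refine measure_mono_null (fun x hx => ?_) h1
    rw [Set.mem_ofPred_eq, ENNReal.one_le_ofReal]
    nlinarith [hx.1]
  norm_num [Real.volume_Icc] at h2

/-- Summability of the `λ_i` gives almost sure convergence of the series controlling `ρ_∞`. -/
theorem ae_summable_lam_mul (a : ℕ → ℝ) (γ σ : ℕ → ℝ≥0) (hγ : ∀ i, 0 < γ i)
    (h : Summable (lam a γ σ)) : ∀ᵐ y ∂(dataLaw a γ σ),
      Summable fun i => lam a γ σ i * ((y i) ^ 2 / dataVar (a i) (γ i) (σ i)) := by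
  have hK : ∫⁻ x, ENNReal.ofReal (x ^ 2) ∂(gaussianReal 0 1) ≠ ∞ := by
    have h2 := (memLp_id_gaussianReal (μ := 0) (v := 1) 2).integrable_sq.2
    rw [hasFiniteIntegral_iff_ofReal (Eventually.of_forall fun x => sq_nonneg _)] at h2
    exact h2.ne
  have hm : ∀ i, Measurable fun y => ENNReal.ofReal (lam a γ σ i) * stdDatumSq a γ σ i y :=
    fun i => (measurable_stdDatumSq a γ σ i).const_mul _
  have hint : ∫⁻ y, ∑' i, ENNReal.ofReal (lam a γ σ i) * stdDatumSq a γ σ i y ∂(dataLaw a γ σ)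
      ≠ ∞ := by
    rw [lintegral_tsum fun i => (hm i).aemeasurable]
    simp only [lintegral_const_mul _ (measurable_stdDatumSq a γ σ _),
      lintegral_stdDatumSq a γ σ hγ]
    rw [ENNReal.tsum_mul_right]
    exact ENNReal.mul_ne_top h.tsum_ofReal_ne_top hK
  filter_upwards [ae_lt_top (Measurable.tsum hm) hint] with y hy
  refine (ENNReal.summable_toReal hy.ne).congr fun i => ?_
  rw [stdDatumSq, ENNReal.toReal_mul, ENNReal.toReal_ofReal (lam_nonneg a γ σ i),
    ENNReal.toReal_ofReal (by positivity)]

theorem rhoInf_lt_top_of_summable (a : ℕ → ℝ) (γ σ : ℕ → ℝ≥0) (hγ : ∀ i, 0 < γ i)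
    (hσ : ∀ i, 0 < σ i) (h : Summable (lam a γ σ)) (y : ℕ → ℝ)
    (hy : Summable fun i => lam a γ σ i * ((y i) ^ 2 / dataVar (a i) (γ i) (σ i))) :
    rhoInf a γ σ y < ∞ := by
  have hs := fun i => pos_of_eq_add (pow_pos (hγ i) 2) (coe_dataVar (a i) (γ i) (σ i))
  have := fun i => isProbabilityMeasure_posteriorOne (a i) (hγ i) (σ i) (y i)
  obtain ⟨G, hGm, hG2, hG⟩ := exists_infinitePi_withDensity_eq
    (π := fun i => priorOne (σ i)) (g := fun i u =>
      gaussianPDFReal (a i * u) ((γ i) ^ 2) (y i) / gaussianPDFReal 0 (dataVar (a i) (γ i) (σ i))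
        (y i))
    (fun i => (measurable_gaussianPDFReal_mean _ _ _).div_const _)
    (fun i u => div_nonneg (gaussianPDFReal_nonneg _ _ _) (gaussianPDFReal_nonneg _ _ _))
    (fun i => by
      rw [integral_div, priorOne, integral_gaussianPDFReal_mean (pow_pos (hσ i) 2)
        (pow_pos (hγ i) 2) (coe_dataVar (a i) (γ i) (σ i))]
      exact div_self (gaussianPDFReal_pos _ _ _ (hs i).ne').ne')
    (fun i => by
      simp only [div_pow, gaussianPDFReal_sq _ (pow_pos (hγ i) 2)]
      exact ((integrable_gaussianPDFReal_mean (pow_pos (hσ i) 2) (half_pos (pow_pos (hγ i) 2))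
        _ _).const_mul _).div_const _)
    (C := Real.exp (∑' i, (lam a γ σ i
      + lam a γ σ i * ((y i) ^ 2 / dataVar (a i) (γ i) (σ i)))))
    (fun n => by
      refine (Finset.prod_le_prod (fun i _ => integral_nonneg fun u => sq_nonneg _) fun i _ =>
        integral_sq_div_gaussianPDFReal_le (pow_pos (hσ i) 2) (pow_pos (hγ i) 2)
          (coe_dataVar (a i) (γ i) (σ i)) (y i)).trans ?_
      rw [← Real.exp_sum, Real.exp_le_exp]
      simp only [← lam_eq]
      exact (h.add hy).sum_le_tsum _ fun i _ =>
        add_nonneg (lam_nonneg a γ σ i) (mul_nonneg (lam_nonneg a γ σ i) (by positivity)))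
    (fun i => posteriorOne (a i) (γ i) (σ i) (y i))
    (fun i => posteriorOne_eq_withDensity (a i) (hγ i) (hσ i) (y i))
  change posteriorInf a γ σ y = (priorInf σ).withDensity G at hG
  have hac : posteriorInf a γ σ y ≪ priorInf σ := by
    rw [hG]
    exact withDensity_absolutelyContinuous _ _
  rw [rhoInf, chiSqDiv, if_pos hac, ENNReal.add_lt_top]
  refine ⟨lt_of_le_of_lt tsub_le_self ?_, ENNReal.one_lt_top⟩
  refine lt_of_eq_of_lt (lintegral_congr_ae ?_) hG2
  filter_upwards [hG ▸ Measure.rnDeriv_withDensity₀ (priorInf σ) hGm] with u hu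
  rw [hu]

theorem absolutelyContinuous_of_rhoInf_lt_top {a : ℕ → ℝ} {γ σ : ℕ → ℝ≥0} {y : ℕ → ℝ}
    (h : rhoInf a γ σ y < ∞) : posteriorInf a γ σ y ≪ priorInf σ := by
  by_contra hac
  rw [rhoInf, chiSqDiv, if_neg hac, top_add] at h
  exact lt_irrefl _ h

/-- Here `λ / (1 + λ)` times the squared standardized datum is the ratio of the squared posterior
mean to the prior variance. -/
theorem tsum_lt_top_of_absolutelyContinuous {a : ℕ → ℝ} {γ σ : ℕ → ℝ≥0} (hγ : ∀ i, 0 < γ i)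
    (hσ : ∀ i, 0 < σ i) {y : ℕ → ℝ} (hac : posteriorInf a γ σ y ≪ priorInf σ) :
    ∑' i, ENNReal.ofReal (lam a γ σ i / (1 + lam a γ σ i)) * stdDatumSq a γ σ i y < ∞ := by
  have hs := fun i => pos_of_eq_add (pow_pos (hγ i) 2) (coe_dataVar (a i) (γ i) (σ i))
  simp only [posteriorInf, priorInf, priorOne,
    posteriorOne_eq_gaussianReal (a _) (hγ _) (hσ _)] at hac
  have h := summable_of_infinitePi_gaussianReal_absolutelyContinuous
    (fun i => pow_pos (hσ i) 2) (fun i => ?_) hac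
  · refine lt_of_eq_of_lt (tsum_congr fun i => ?_) h.tsum_ofReal_lt_top
    have hl := lam_nonneg a γ σ i
    rw [stdDatumSq, ← ENNReal.ofReal_mul (by positivity)]
    congr 1
    have hs' : (0 : ℝ) < dataVar (a i) (γ i) (σ i) := hs i
    have hγ' : (0 : ℝ) < γ i := hγ i
    have hσ' : (0 : ℝ) < σ i := hσ i
    have h1 : 1 + lam a γ σ i = dataVar (a i) (γ i) (σ i) / (γ i : ℝ) ^ 2 := by
      rw [coe_dataVar, lam]
      push_cast
      field_simp
    rw [h1, lam]
    push_cast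
    field_simp
  · rw [div_le_iff₀ (hs i)]
    refine mul_le_mul_right ?_ _
    exact le_self_add

theorem summable_lam_of_ae_absolutelyContinuous {a : ℕ → ℝ} {γ σ : ℕ → ℝ≥0}
    (hγ : ∀ i, 0 < γ i) (hσ : ∀ i, 0 < σ i)
    (h : ∀ᵐ y ∂(dataLaw a γ σ), posteriorInf a γ σ y ≪ priorInf σ) :
    Summable (lam a γ σ) := by
  refine summable_of_summable_div_one_add (lam_nonneg a γ σ) ?_
  have h1 := tsum_lt_top_of_ae_tsum_mul_lt_top (measurable_stdDatumSq a γ σ)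
    gaussianReal_one_le_sq_ne_zero (fun i => (measure_one_le_stdDatumSq a γ σ hγ i).ge)
    (fun i => ENNReal.ofReal (lam a γ σ i / (1 + lam a γ σ i)))
    (h.mono fun y hy => tsum_lt_top_of_absolutelyContinuous hγ hσ hy)
  refine (ENNReal.summable_toReal h1.ne).congr fun i => ?_
  have := lam_nonneg a γ σ i
  exact ENNReal.toReal_ofReal (by positivity)

end Model

end LinearGaussian

theorem mainTheorem4 (a : ℕ → ℝ) (γ σ : ℕ → ℝ≥0) (hγ : ∀ i, 0 < γ i) (hσ : ∀ i, 0 < σ i) :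
    List.TFAE
      [LinearGaussian.tau a γ σ < ∞,
        ∀ᵐ y ∂(LinearGaussian.dataLaw a γ σ), LinearGaussian.rhoInf a γ σ y < ∞,
        ∀ᵐ y ∂(LinearGaussian.dataLaw a γ σ),
          LinearGaussian.posteriorInf a γ σ y ≪ LinearGaussian.priorInf σ] := by
  rw [LinearGaussian.tau_lt_top_iff]
  tfae_have 1 → 2 := fun h =>
    (LinearGaussian.ae_summable_lam_mul a γ σ hγ h).mono
      (LinearGaussian.rhoInf_lt_top_of_summable a γ σ hγ hσ h)
  tfae_have 2 → 3 := fun h =>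
    h.mono fun _ => LinearGaussian.absolutelyContinuous_of_rhoInf_lt_top
  tfae_have 3 → 1 := LinearGaussian.summable_lam_of_ae_absolutelyContinuous hγ hσ
  tfae_finish
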